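/- Let $k\ge 2$ and $d\ge 2$ be integers, let $\alpha_2,\dots,\alpha_k\in\mathbb{C}$ with $\alpha_2\neq 0$ and $|\alpha_2|<d$, and let $H:\mathbb{C}^k\to\mathbb{C}^k$ be the automorphism $$H(z_1,\dots,z_k)=\bigl(z_1^d+\alpha_2z_2+\cdots+\alpha_kz_k,\ z_3,\ \dots,\ z_k,\ z_1\bigr).$$ Let $p=[1:0:\cdots:0]\in\mathbb{P}^k(\mathbb{C})\supset\mathbb{C}^k$, where $(z_1,\dots,z_k)$ is identified with $[z_1:\cdots:z_k:1]$, and let $U^+=\{w\in\mathbb{C}^k : H^n(w)\to p \text{ as } n\to\infty\}$. For $R>0$ let $V^+=\{z\in\mathbb{C}^k : |z_1|>\max(R,|z_2|,\dots,|z_k|)\}$. For $R$ large, $U^+=\bigcup_{n\ge 0} H^{-n}(V^+)$, and $$\varphi(z)=z_1\exp\Bigl(\sum_{n\ge 0}d^{-(n+1)}\beta(H^n(z))\Bigr),\qquad \beta(z)=\log\Bigl(1+\frac{\alpha_2z_2+\cdots+\alpha_kz_k}{z_1^d}\Bigr)$$ (principal logarithm) is the holomorphic function on $V^+$ with $\varphi\circ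 H=\varphi^d$ and $\varphi(z)\sim z_1$ as $|z_1|\to\infty$ in $V^+$. Let $\omega$ be the closed $1$-form on $U^+$ given by $\omega=d^{-n}(H^n)^*(\mathrm{d}\varphi/\varphi)$ on $H^{-n}(V^+)$ for every $n\ge 0$; it does not depend on the choice of large $R$. For a closed (continuous) curve $C$ in $U^+$ put $$\alpha(C)=\frac{1}{2i\pi}\int_C\omega ,$$ where the integral of a closed $1$-form along a continuous curve is defined by means of local primitives along the curve. Then $U^+$ is path connected and, for all sufficiently large $R$, the integral defining $\alpha(C)$ exists for every closed curve $C$ in $U^+$, and: 1. $\alpha(H(C))=d\,\alpha(C)$ for every closed curve $C$ in $U^+$; 2. $\alpha(C)\in\mathbb{Z}[1/d]$ for every closed curve $C$ in $U^+$; 3. a closed curve $C$ in $U^+$ is null-homotopic in $U^+$ if and only if $\alpha(C)=0$; 4. for every $r\in\mathbb{Z}[1/d]$ there is a closed curve $C$ in $U^+$ with $\alpha(C)=r$. Moreover, for every base point $x\in U^+$, $\alpha$ induces a group isomorphism $\pi_1(U^+,x)\cong\mathbb{Z}[1/d]$, $[C]\mapsto\alpha(C)$, onto the additive group $\mathbb{Z}[1/d]$.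 -/

import Mathlib

open Filter Topology

noncomputable section

namespace AttractingBasin

/-! ### Integral of a closed 1-form along a continuous path -/

section PathIntegral

variable {E : Type*} [NormedAddCommGroup E] [NormedSpace ℂ E]

/-- `F` is a primitive of the 1-form `ω` along the continuous path `γ : [0,1] → E`: near every
parameter `t`, `F` is of the form `f ∘ γ`, where `f` is a primitive of `ω` near `γ t`. -/
def IsPrimitiveAlong (ω : E → E →L[ℂ] ℂ) {x y : E} (γ : Path x y) (F : unitInterval → ℂ) : Prop :=
  ∀ t, ∃ f : E → ℂ, (∀ᶠ z in 𝓝 (γ t), HasFDerivAt f (ω z) z) ∧ ∀ᶠ s in 𝓝 t, F s = f (γ s)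

/-- The integral of the 1-form `ω` along the continuous path `γ` exists. This is the case for every
continuous path in an open set on which `ω` is closed (i.e. is locally the differential of a
function). -/
def FormIntegrable (ω : E → E →L[ℂ] ℂ) {x y : E} (γ : Path x y) : Prop :=
  ∃ F, IsPrimitiveAlong ω γ F

open Classical in
/-- The integral `∫_γ ω` of a (closed) 1-form along a continuous path: `F 1 - F 0` for a
primitive `F` of `ω` along `γ`. It is independent of `F` (`formIntegral_eq`), and it is the usual
integral of `ω (γ t) (γ' t)` over `[0,1]` for piecewise smooth `γ`
(`formIntegral_eq_curveIntegral`). -/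
def formIntegral (ω : E → E →L[ℂ] ℂ) {x y : E} (γ : Path x y) : ℂ :=
  if h : FormIntegrable ω γ then h.choose 1 - h.choose 0 else 0

theorem IsPrimitiveAlong.sub_eq {ω : E → E →L[ℂ] ℂ} {x y : E} {γ : Path x y}
    {F G : unitInterval → ℂ} (hF : IsPrimitiveAlong ω γ F) (hG : IsPrimitiveAlong ω γ G) :
    F 1 - F 0 = G 1 - G 0 := by
  have hloc : IsLocallyConstant (fun t => F t - G t) := by
    rw [IsLocallyConstant.iff_eventually_eq]
    intro t
    obtain ⟨f, hf, hfF⟩ := hF t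
    obtain ⟨g, hg, hgG⟩ := hG t
    obtain ⟨ε, hε, hball⟩ := Metric.eventually_nhds_iff_ball.1 (hf.and hg)
    have hconst : ∀ z ∈ Metric.ball (γ t) ε, f z - g z = f (γ t) - g (γ t) := by
      intro z hz
      refine (convex_ball (γ t) ε).is_const_of_fderivWithin_eq_zero (𝕜 := ℂ)
        (f := fun z => f z - g z) ?_ ?_ hz (Metric.mem_ball_self hε)
      · intro w hw
        exact ((hball w hw).1.sub (hball w hw).2).differentiableAt.differentiableWithinAt
      · intro w hw
        have h := (hball w hw).1.sub (hball w hw).2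
        rw [sub_self] at h
        exact h.hasFDerivWithinAt.fderivWithin (Metric.isOpen_ball.uniqueDiffWithinAt hw)
    have hγ : ∀ᶠ s in 𝓝 t, γ s ∈ Metric.ball (γ t) ε :=
      γ.continuous.continuousAt.eventually (Metric.ball_mem_nhds _ hε)
    filter_upwards [hfF, hgG, hγ] with s h1 h2 h3
    rw [h1, h2, hfF.self_of_nhds, hgG.self_of_nhds, hconst _ h3]
  have h := hloc.apply_eq_of_preconnectedSpace 1 0
  linear_combination h

theorem formIntegral_eq {ω : E → E →L[ℂ] ℂ} {x y : E} {γ : Path x y}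
    {F : unitInterval → ℂ} (hF : IsPrimitiveAlong ω γ F) : formIntegral ω γ = F 1 - F 0 := by
  have h : FormIntegrable ω γ := ⟨F, hF⟩
  rw [formIntegral, dif_pos h]
  exact h.choose_spec.sub_eq hF

/-- For a path that is differentiable outside a countable set of parameters and along which `ω` is
integrable in the elementary sense (e.g. a piecewise `C¹` path), `formIntegral` is the
elementary curve integral. -/
theorem formIntegral_eq_curveIntegral {ω : E → E →L[ℂ] ℂ} {x y : E} {γ : Path x y}
    (h : FormIntegrable ω γ) {S : Set ℝ} (hS : S.Countable)
    (hd : ∀ t ∈ Set.Ioo (0 : ℝ) 1 \ S, DifferentiableAt ℝ γ.extend t)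
    (hi : CurveIntegrable ω γ) : formIntegral ω γ = curveIntegral ω γ := by
  obtain ⟨F, hF⟩ := h
  rw [formIntegral_eq hF, curveIntegral_def]
  have hcont : Continuous F := by
    rw [continuous_iff_continuousAt]
    intro t
    obtain ⟨f, hf, hfF⟩ := hF t
    have : ContinuousAt (fun s => f (γ s)) t :=
      ContinuousAt.comp (f := γ) hf.self_of_nhds.continuousAt γ.continuous.continuousAt
    exact this.congr (hfF.mono fun _ hs => hs.symm)
  have key := MeasureTheory.integral_eq_of_hasDerivAt_off_countable_of_le
    (Set.IccExtend (zero_le_one' ℝ) F) (curveIntegralFun ω γ) zero_le_one hS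
    (hcont.Icc_extend' (h := zero_le_one' ℝ)).continuousOn ?_ hi
  · have h1 : Set.IccExtend (zero_le_one' ℝ) F 1 = F 1 := Set.IccExtend_right _ _
    have h0 : Set.IccExtend (zero_le_one' ℝ) F 0 = F 0 := Set.IccExtend_left _ _
    rw [h1, h0] at key
    rw [← key]
  · intro t ht
    have htI : t ∈ Set.Icc (0 : ℝ) 1 := Set.Ioo_subset_Icc_self ht.1
    obtain ⟨f, hf, hfF⟩ := hF ⟨t, htI⟩
    have hγt : γ.extend t = γ ⟨t, htI⟩ := γ.extend_apply htI
    have hf' : HasFDerivAt f ((ω (γ.extend t)).restrictScalars ℝ) (γ.extend t) := by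
      rw [hγt]; exact hf.self_of_nhds.restrictScalars ℝ
    have hder := hf'.comp_hasDerivAt t (hd t ht).hasDerivAt
    have hnhds : Set.Icc (0 : ℝ) 1 ∈ 𝓝 t := Icc_mem_nhds ht.1.1 ht.1.2
    rw [curveIntegralFun_def, derivWithin_of_mem_nhds hnhds]
    refine HasDerivAt.congr_of_eventuallyEq hder ?_
    have hproj : Tendsto (Set.projIcc (0 : ℝ) 1 zero_le_one) (𝓝 t) (𝓝 ⟨t, htI⟩) := by
      have := (continuous_projIcc (h := zero_le_one' ℝ)).tendsto t
      rwa [Set.projIcc_of_mem _ htI] at this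
    filter_upwards [hproj.eventually hfF] with s hs
    exact hs

end PathIntegral

/-! ### The automorphism, the attracting basin and the closed form

Throughout, `k = m + 2`; the point `(z₁, …, z_k)` of `ℂ^k` is `z : Fin (m + 2) → ℂ` with
`z_{i+1} = z i`, and the coefficients `α₂, …, α_k` are `a : Fin (m + 1) → ℂ` with
`α_{j+2} = a j`. -/

variable {m : ℕ}

/-- The linear part `α₂ z₂ + ⋯ + α_k z_k`. -/
def linPart (a : Fin (m + 1) → ℂ) (z : Fin (m + 2) → ℂ) : ℂ :=
  ∑ j : Fin (m + 1), a j * z j.succ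

/-- The map `H(z₁, …, z_k) = (z₁^d + α₂ z₂ + ⋯ + α_k z_k, z₃, …, z_k, z₁)`. The index `i.succ + 1`
is computed modulo `k`, so the last component is `z 0`, i.e. `z₁`. -/
def H (d : ℕ) (a : Fin (m + 1) → ℂ) (z : Fin (m + 2) → ℂ) : Fin (m + 2) → ℂ :=
  Fin.cons (z 0 ^ d + linPart a z) (fun i : Fin (m + 1) => z (i.succ + 1))

theorem continuous_H (d : ℕ) (a : Fin (m + 1) → ℂ) : Continuous (H d a) := by
  refine continuous_pi fun i => ?_
  refine Fin.cases ?_ (fun j => ?_) i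
  · simp only [H, Fin.cons_zero, linPart]
    fun_prop
  · simp only [H, Fin.cons_succ]
    fun_prop

/-- The quotient topology on complex projective space `ℙ^n`. -/
instance projectiveTopology (n : ℕ) :
    TopologicalSpace (Projectivization ℂ (Fin (n + 1) → ℂ)) :=
  inferInstanceAs (TopologicalSpace (Quotient (projectivizationSetoid ℂ (Fin (n + 1) → ℂ))))

/-- The embedding `ℂ^k → ℙ^k`, `(z₁, …, z_k) ↦ [z₁ : ⋯ : z_k : 1]`. -/
def toProj (z : Fin (m + 2) → ℂ) : Projectivization ℂ (Fin (m + 3) → ℂ) :=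
  Projectivization.mk ℂ (Fin.snoc (α := fun _ => ℂ) z 1) (by
    intro h
    have := congrFun h (Fin.last _)
    simp at this)

/-- The point `p = [1 : 0 : ⋯ : 0]` of `ℙ^k`. -/
def pointP (m : ℕ) : Projectivization ℂ (Fin (m + 3) → ℂ) :=
  Projectivization.mk ℂ (Pi.single 0 1) (by
    intro h
    have := congrFun h 0
    simp at this)

/-- The attracting basin `U⁺ = {w ∈ ℂ^k | H^n(w) → p in ℙ^k}`. -/
def Uplus (d : ℕ) (a : Fin (m + 1) → ℂ) : Set (Fin (m + 2) → ℂ) :=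
  {w | Tendsto (fun n : ℕ => toProj ((H d a)^[n] w)) atTop (𝓝 (pointP m))}

theorem H_mem_Uplus {d : ℕ} {a : Fin (m + 1) → ℂ} {w : Fin (m + 2) → ℂ} (hw : w ∈ Uplus d a) :
    H d a w ∈ Uplus d a :=
  (tendsto_add_atTop_iff_nat (f := fun n : ℕ => toProj ((H d a)^[n] w)) 1).2 hw

/-- `H` as a map from `U⁺` to itself. -/
def HU (d : ℕ) (a : Fin (m + 1) → ℂ) (w : Uplus d a) : Uplus d a :=
  ⟨H d a w, H_mem_Uplus w.2⟩

theorem continuous_HU (d : ℕ) (a : Fin (m + 1) → ℂ) : Continuous (HU d a) :=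
  ((continuous_H d a).comp continuous_subtype_val).subtype_mk _

/-- `V⁺ = {z | |z₁| > max(R, |z₂|, …, |z_k|)}`. -/
def Vplus (m : ℕ) (R : ℝ) : Set (Fin (m + 2) → ℂ) :=
  {z | R < ‖z 0‖ ∧ ∀ j : Fin (m + 1), ‖z j.succ‖ < ‖z 0‖}

/-- `β(z) = log (1 + (α₂ z₂ + ⋯ + α_k z_k) / z₁^d)` (principal branch: on `V⁺` with `R` large the
argument is close to `1`), so that the first component of `H(z)` is `z₁^d exp(β(z))`. -/
def beta (d : ℕ) (a : Fin (m + 1) → ℂ) (z : Fin (m + 2) → ℂ) : ℂ :=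
  Complex.log (1 + linPart a z / z 0 ^ d)

/-- `φ(z) = z₁ exp(β(z)/d + β(H(z))/d² + β(H²(z))/d³ + ⋯)`: the holomorphic function on `V⁺` (for
`R` large) with `φ ∘ H = φ^d` and `φ(z) ∼ z₁` as `|z₁| → ∞`. Only its values on `V⁺` are used. -/
def phi (d : ℕ) (a : Fin (m + 1) → ℂ) (z : Fin (m + 2) → ℂ) : ℂ :=
  z 0 * Complex.exp (∑' n : ℕ, beta d a ((H d a)^[n] z) / (d : ℂ) ^ (n + 1))

/-- The 1-form `dφ/φ` on `V⁺`. -/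
def dlogPhi (d : ℕ) (a : Fin (m + 1) → ℂ) (z : Fin (m + 2) → ℂ) : (Fin (m + 2) → ℂ) →L[ℂ] ℂ :=
  (phi d a z)⁻¹ • fderiv ℂ (phi d a) z

open Classical in
/-- The closed 1-form `ω` on `U⁺ = ⋃ₙ H⁻ⁿ(V⁺)`: at `w ∈ H⁻ⁿ(V⁺)` it is
`d⁻ⁿ (Hⁿ)^* (dφ/φ)`. As `H^*(dφ/φ) = d · dφ/φ` on `V⁺`, every such `n` gives the same
value; the least one is taken. -/
def omega (d : ℕ) (a : Fin (m + 1) → ℂ) (R : ℝ) (w : Fin (m + 2) → ℂ) :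
    (Fin (m + 2) → ℂ) →L[ℂ] ℂ :=
  if h : ∃ n : ℕ, (H d a)^[n] w ∈ Vplus m R then
    ((d : ℂ) ^ Nat.find h)⁻¹ •
      (dlogPhi d a ((H d a)^[Nat.find h] w)).comp (fderiv ℂ ((H d a)^[Nat.find h]) w)
  else 0

/-- A path in `U⁺` as a path in `ℂ^k`. -/
def ambient {d : ℕ} {a : Fin (m + 1) → ℂ} {x y : Uplus d a} (C : Path x y) :
    Path (x : Fin (m + 2) → ℂ) (y : Fin (m + 2) → ℂ) :=
  C.map continuous_subtype_val

/-- `α(C) = (1 / 2iπ) ∫_C ω` for a closed curve `C` in `U⁺`. -/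
def alpha {d : ℕ} {a : Fin (m + 1) → ℂ} (R : ℝ) {x : Uplus d a} (C : Path x x) : ℂ :=
  1 / (2 * Complex.I * Real.pi) * formIntegral (omega d a R) (ambient C)

/-- The ring `ℤ[1/d]`, as a subring of `ℂ`. -/
abbrev ZInv (d : ℕ) : Subalgebra ℤ ℂ := Algebra.adjoin ℤ {1 / (d : ℂ)}

end AttractingBasin

end

/-! On `V⁺` the term `z₁^d` dominates, so `H` maps `V⁺` into itself while `|z₁|` at least doubles.
Hence `U⁺` is the increasing union of the sets `H⁻ⁿ(V⁺)`. The coordinates `(z₁, z_j/z₁)` identify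
`V⁺` with the exterior of a disc times a polydisc, so each `H⁻ⁿ(V⁺)` is a homotopy circle on which
the winding number of the first coordinate of `Hⁿ` classifies loops. Passing from `n` to `n + 1`
multiplies this winding number by `d`, so the fundamental group of the union is the limit of `ℤ → ℤ
→ ⋯` under multiplication by `d`, namely `ℤ[1/d]`.

The form `ω` computes the normalized winding number. Indeed `log φ = log z₁ + phiExponent`, and
`phiExponent` is single-valued on `V⁺`, so only the increment of `log z₁` survives on a closed
curve. This is `IsLogAlong.alpha_eq`: for a loop carried into `V⁺` by `Hⁿ`, `α` is the winding
number divided by `dⁿ`. A common `n` exists for any compact family of points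
(`exists_forall_iterate_mem_Vplus`).

Homotopy invariance comes from lifting through `exp`. Conversely, `basinPolar` covers `H⁻ⁿ(V⁺)` by a
convex set. A loop with `α = 0` lifts to a loop there and is contracted linearly, while paths in the
convex set whose ends differ by `2πij` realize every `j/dⁿ`. -/

noncomputable section

namespace AttractingBasin

variable {m : ℕ}

/-! ### Dynamics near the attracting point -/

/-- The sum of the absolute values of the coefficients of the linear part. -/
def coeffBound (a : Fin (m + 1) → ℂ) : ℝ := ∑ j, ‖a j‖

theorem coeffBound_nonneg (a : Fin (m + 1) → ℂ) : 0 ≤ coeffBound a :=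
  Finset.sum_nonneg fun _ _ => norm_nonneg _

theorem norm_linPart_le (a : Fin (m + 1) → ℂ) {z : Fin (m + 2) → ℂ}
    (hz : ∀ j : Fin (m + 1), ‖z j.succ‖ ≤ ‖z 0‖) : ‖linPart a z‖ ≤ coeffBound a * ‖z 0‖ := by
  rw [linPart, coeffBound, Finset.sum_mul]
  refine (norm_sum_le _ _).trans (Finset.sum_le_sum fun j _ => ?_)
  rw [norm_mul]
  exact mul_le_mul_of_nonneg_left (hz j) (norm_nonneg _)

@[simp] theorem H_zero (d : ℕ) (a : Fin (m + 1) → ℂ) (z : Fin (m + 2) → ℂ) :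
    H d a z 0 = z 0 ^ d + linPart a z := rfl

@[simp] theorem H_succ (d : ℕ) (a : Fin (m + 1) → ℂ) (z : Fin (m + 2) → ℂ) (i : Fin (m + 1)) :
    H d a z i.succ = z (i.succ + 1) := rfl

theorem norm_apply_le_of_mem_Vplus {R : ℝ} {z : Fin (m + 2) → ℂ} (hz : z ∈ Vplus m R)
    (i : Fin (m + 2)) : ‖z i‖ ≤ ‖z 0‖ := by
  refine Fin.cases le_rfl (fun j => (hz.2 j).le) i

theorem isOpen_Vplus (m : ℕ) (R : ℝ) : IsOpen (Vplus m R) := by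
  have : Vplus m R = {z | R < ‖z 0‖} ∩ ⋂ j : Fin (m + 1), {z | ‖z j.succ‖ < ‖z 0‖} := by
    ext z; simp [Vplus]
  rw [this]
  refine (isOpen_lt (by fun_prop) (by fun_prop)).inter (isOpen_iInter_of_finite fun j => ?_)
  exact isOpen_lt (by fun_prop) (by fun_prop)

section Growth

variable {d : ℕ} {a : Fin (m + 1) → ℂ} {R : ℝ} {z : Fin (m + 2) → ℂ}

/-- The linear part is at most `coeffBound a * |z₁|` and `|z₁|^d ≥ |z₁|²`. The threshold `2 *
coeffBound a + 3` makes the factor `|z₁| - coeffBound a` exceed `2`, and later keeps the argument of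
the logarithm in `beta` within `1/2` of `1`. -/
theorem norm_zero_mul_le_norm_H (hd : 2 ≤ d) (hR : 2 * coeffBound a + 3 ≤ R)
    (hz : z ∈ Vplus m R) : (‖z 0‖ - coeffBound a) * ‖z 0‖ ≤ ‖H d a z 0‖ := by
  have hA := coeffBound_nonneg a
  have h1 : ‖z 0‖ ^ 2 ≤ ‖z 0‖ ^ d := pow_le_pow_right₀ (by linarith [hz.1]) hd
  have h2 := norm_linPart_le a fun j => (hz.2 j).le
  have h3 : ‖z 0‖ ^ d - ‖linPart a z‖ ≤ ‖H d a z 0‖ := by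
    rw [H_zero, ← norm_pow]
    have := norm_sub_norm_le (z 0 ^ d) (-linPart a z)
    rwa [norm_neg, sub_neg_eq_add] at this
  nlinarith

theorem two_mul_norm_zero_le_norm_H (hd : 2 ≤ d) (hR : 2 * coeffBound a + 3 ≤ R)
    (hz : z ∈ Vplus m R) : 2 * ‖z 0‖ ≤ ‖H d a z 0‖ := by
  refine le_trans ?_ (norm_zero_mul_le_norm_H hd hR hz)
  have hA := coeffBound_nonneg a
  exact mul_le_mul_of_nonneg_right (by linarith [hz.1]) (norm_nonneg _)

theorem H_mem_Vplus (hd : 2 ≤ d) (hR : 2 * coeffBound a + 3 ≤ R) (hz : z ∈ Vplus m R) :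
    H d a z ∈ Vplus m R := by
  have hA := coeffBound_nonneg a
  have h := two_mul_norm_zero_le_norm_H hd hR hz
  have h1 := hz.1
  refine ⟨by linarith, fun j => ?_⟩
  rw [H_succ]
  have := norm_apply_le_of_mem_Vplus hz (j.succ + 1)
  linarith

theorem iterate_mem_Vplus (hd : 2 ≤ d) (hR : 2 * coeffBound a + 3 ≤ R) (hz : z ∈ Vplus m R)
    (n : ℕ) : (H d a)^[n] z ∈ Vplus m R :=
  Set.MapsTo.iterate (fun _ h => H_mem_Vplus hd hR h) n hz

theorem iterate_mem_Vplus_of_le (hd : 2 ≤ d) (hR : 2 * coeffBound a + 3 ≤ R) {k n : ℕ}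
    (hkn : k ≤ n) (hz : (H d a)^[k] z ∈ Vplus m R) : (H d a)^[n] z ∈ Vplus m R := by
  obtain ⟨j, rfl⟩ := Nat.exists_eq_add_of_le hkn
  rw [add_comm k j, Function.iterate_add_apply]
  exact iterate_mem_Vplus hd hR hz j

theorem two_pow_mul_le_norm_iterate (hd : 2 ≤ d) (hR : 2 * coeffBound a + 3 ≤ R)
    (hz : z ∈ Vplus m R) (n : ℕ) : 2 ^ n * R ≤ ‖(H d a)^[n] z 0‖ := by
  induction n with
  | zero => simpa using hz.1.le
  | succ n ih =>
    rw [Function.iterate_succ_apply']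
    have := two_mul_norm_zero_le_norm_H hd hR (iterate_mem_Vplus hd hR hz n)
    rw [pow_succ]
    linarith

theorem tendsto_norm_iterate (hd : 2 ≤ d) (hR : 2 * coeffBound a + 3 ≤ R)
    (hz : z ∈ Vplus m R) : Tendsto (fun n => ‖(H d a)^[n] z 0‖) atTop atTop := by
  have hA := coeffBound_nonneg a
  refine tendsto_atTop_mono (two_pow_mul_le_norm_iterate hd hR hz) ?_
  exact (tendsto_pow_atTop_atTop_of_one_lt one_lt_two).atTop_mul_const (by linarith)

/-- Every coordinate of `H(w)` but the first is a coordinate of `w`, hence at most `|w₁|`, while the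
first is at least `(|w₁| - coeffBound a)|w₁|`. The ratio is thus at most `(|w₁| - coeffBound a)⁻¹`.
-/
theorem tendsto_ratio_iterate (hd : 2 ≤ d) (hR : 2 * coeffBound a + 3 ≤ R)
    (hz : z ∈ Vplus m R) (j : Fin (m + 1)) :
    Tendsto (fun n => (H d a)^[n] z j.succ / (H d a)^[n] z 0) atTop (𝓝 0) := by
  have hA := coeffBound_nonneg a
  rw [← tendsto_add_atTop_iff_nat 1]
  have h0 : Tendsto (fun n => (‖(H d a)^[n] z 0‖ - coeffBound a)⁻¹) atTop (𝓝 0) :=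
    (tendsto_atTop_add_const_right _ _ (tendsto_norm_iterate hd hR hz)).inv_tendsto_atTop
  refine squeeze_zero_norm (fun n => ?_) h0
  have hn := iterate_mem_Vplus hd hR hz n
  rw [Function.iterate_succ_apply', H_succ, norm_div]
  set w := (H d a)^[n] z
  have h1 := norm_zero_mul_le_norm_H hd hR hn
  have h2 := norm_apply_le_of_mem_Vplus hn (j.succ + 1)
  have h3 : 0 < ‖w 0‖ := by linarith [hn.1]
  have h4 : 0 < ‖w 0‖ - coeffBound a := by linarith [hn.1]
  rw [div_le_iff₀ (lt_of_lt_of_le (by positivity) h1), inv_mul_eq_div, le_div_iff₀ h4]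
  nlinarith

end Growth

/-! ### Convergence to `p` in projective space -/

theorem continuous_projectivization_mk {n : ℕ} {X : Type*} [TopologicalSpace X]
    {f : X → Fin (n + 1) → ℂ} (hf : Continuous f) (h0 : ∀ x, f x ≠ 0) :
    Continuous fun x => Projectivization.mk ℂ (f x) (h0 x) :=
  continuous_quotient_mk'.comp (hf.subtype_mk h0)

theorem toProj_eq {z : Fin (m + 2) → ℂ} (hz : z 0 ≠ 0) :
    toProj z = Projectivization.mk ℂ
      (Fin.cons 1 (fun i : Fin (m + 2) =>
        (Fin.snoc (α := fun _ => ℂ) z 1 : Fin (m + 3) → ℂ) i.succ / z 0) : Fin (m + 3) → ℂ)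
      (fun h => one_ne_zero (α := ℂ) (congrFun h 0)) := by
  rw [toProj, Projectivization.mk_eq_mk_iff']
  refine ⟨z 0, ?_⟩
  funext i
  refine Fin.cases ?_ (fun j => ?_) i
  · simp only [Pi.smul_apply, Fin.cons_zero, smul_eq_mul, mul_one]
    exact (Fin.snoc_castSucc (α := fun _ => ℂ) 1 z 0).symm
  · simp only [Pi.smul_apply, Fin.cons_succ, smul_eq_mul]
    field_simp

theorem tendsto_toProj_pointP {w : ℕ → Fin (m + 2) → ℂ}
    (h0 : Tendsto (fun n => ‖w n 0‖) atTop atTop)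
    (hj : ∀ j : Fin (m + 1), Tendsto (fun n => w n j.succ / w n 0) atTop (𝓝 0)) :
    Tendsto (fun n => toProj (w n)) atTop (𝓝 (pointP m)) := by
  have hcont : Continuous fun u : Fin (m + 2) → ℂ =>
      Projectivization.mk ℂ (Fin.cons 1 u : Fin (m + 3) → ℂ)
        (fun h => one_ne_zero (α := ℂ) (congrFun h 0)) := by
    refine continuous_projectivization_mk ?_ _
    refine continuous_pi fun i => Fin.cases ?_ (fun j => ?_) i
    · simp only [Fin.cons_zero]; fun_prop
    · simp only [Fin.cons_succ]; fun_prop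
  have hp : pointP m = Projectivization.mk ℂ (Fin.cons 1 0 : Fin (m + 3) → ℂ)
      (fun h => one_ne_zero (α := ℂ) (congrFun h 0)) := by
    rw [pointP]
    congr 1
    funext i
    refine Fin.cases ?_ (fun j => ?_) i
    · simp
    · simp
  rw [hp]
  have ht : Tendsto (fun n => (fun i : Fin (m + 2) =>
      (Fin.snoc (α := fun _ => ℂ) (w n) 1 : Fin (m + 3) → ℂ) i.succ / w n 0)) atTop (𝓝 0) := by
    rw [tendsto_pi_nhds]
    intro i
    refine Fin.lastCases ?_ (fun j => ?_) i
    · simp only [Fin.succ_last, Fin.snoc_last, one_div, Pi.zero_apply]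
      rw [tendsto_zero_iff_norm_tendsto_zero]
      simp only [norm_inv]
      exact h0.inv_tendsto_atTop
    · simp only [Fin.succ_castSucc, Fin.snoc_castSucc]
      exact hj j
  refine ((hcont.tendsto 0).comp ht).congr' ?_
  filter_upwards [h0.eventually_gt_atTop 0] with n hn
  exact (toProj_eq (norm_pos_iff.1 hn)).symm

theorem eventually_mem_Vplus_of_tendsto_toProj {w : ℕ → Fin (m + 2) → ℂ} (R : ℝ)
    (h : Tendsto (fun n => toProj (w n)) atTop (𝓝 (pointP m))) :
    ∀ᶠ n in atTop, w n ∈ Vplus m R := by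
  -- A neighbourhood of `p` given by homogeneous inequalities. At `[z : 1]` the last coordinate
  -- yields `|z₁| > |R| + 1`, and since the factor is at least `1` the others yield `|z_j| < |z₁|`.
  let S : Set (Projectivization ℂ (Fin (m + 3) → ℂ)) :=
    {q | ∀ i : Fin (m + 2), (|R| + 1) * ‖q.rep i.succ‖ < ‖q.rep 0‖}
  have hS : ∀ (v : Fin (m + 3) → ℂ) (hv : v ≠ 0), Projectivization.mk ℂ v hv ∈ S ↔
      ∀ i : Fin (m + 2), (|R| + 1) * ‖v i.succ‖ < ‖v 0‖ := by
    intro v hv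
    obtain ⟨c, hc⟩ := Projectivization.exists_smul_eq_mk_rep ℂ v hv
    have hc0 : 0 < ‖(c : ℂ)‖ := norm_pos_iff.2 c.ne_zero
    simp only [S, Set.mem_ofPred_eq, ← hc, Pi.smul_apply, Units.smul_def, norm_smul]
    refine forall_congr' fun i => ?_
    rw [mul_left_comm, mul_lt_mul_iff_right₀ hc0]
  have hopen : IsOpen S := by
    refine isOpen_coinduced.2 ?_
    have : (Quotient.mk (projectivizationSetoid ℂ (Fin (m + 3) → ℂ))) ⁻¹' S =
        ⋂ i : Fin (m + 2), {v : {v : Fin (m + 3) → ℂ // v ≠ 0} |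
          (|R| + 1) * ‖v.1 i.succ‖ < ‖v.1 0‖} := by
      ext v
      simp only [Set.mem_iInter, Set.mem_ofPred_eq]
      exact hS v.1 v.2
    refine this ▸ isOpen_iInter_of_finite fun i => ?_
    have hc (j : Fin (m + 3)) :
        Continuous fun v : {v : Fin (m + 3) → ℂ // v ≠ 0} => ‖v.1 j‖ :=
      ((continuous_apply j).comp continuous_subtype_val).norm
    exact isOpen_lt (continuous_const.mul (hc _)) (hc _)
  have hmem : pointP m ∈ S := by
    rw [pointP, hS]
    intro i
    simp
  filter_upwards [h.eventually (hopen.mem_nhds hmem)] with n hn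
  replace hn := (hS _ _).1 hn
  have h0 : (Fin.snoc (α := fun _ => ℂ) (w n) 1 : Fin (m + 3) → ℂ) 0 = w n 0 :=
    Fin.snoc_castSucc (α := fun _ => ℂ) 1 (w n) 0
  rw [h0] at hn
  refine ⟨?_, fun j => ?_⟩
  · have := hn (Fin.last _)
    rw [Fin.succ_last, Fin.snoc_last, norm_one, mul_one] at this
    linarith [le_abs_self R]
  · have := hn j.castSucc
    rw [Fin.succ_castSucc, Fin.snoc_castSucc] at this
    nlinarith [abs_nonneg R, norm_nonneg (w n j.succ)]

/-! ### The basin as the increasing union of the preimages of `V⁺` -/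

section Basin

variable {d : ℕ} {a : Fin (m + 1) → ℂ} {R : ℝ}

theorem Vplus_subset_Uplus (hd : 2 ≤ d) (hR : 2 * coeffBound a + 3 ≤ R) :
    Vplus m R ⊆ Uplus d a := fun _ hz =>
  tendsto_toProj_pointP (tendsto_norm_iterate hd hR hz) (tendsto_ratio_iterate hd hR hz)

theorem mem_Uplus_of_iterate_mem {w : Fin (m + 2) → ℂ} (n : ℕ)
    (hw : (H d a)^[n] w ∈ Uplus d a) : w ∈ Uplus d a := by
  refine (tendsto_add_atTop_iff_nat (f := fun n : ℕ => toProj ((H d a)^[n] w)) n).1 ?_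
  have hw' : Tendsto _ _ _ := hw
  simpa only [Function.iterate_add_apply] using hw'

theorem exists_iterate_mem_Vplus {w : Fin (m + 2) → ℂ} (hw : w ∈ Uplus d a) (R : ℝ) :
    ∃ n, (H d a)^[n] w ∈ Vplus m R :=
  (eventually_mem_Vplus_of_tendsto_toProj R hw).exists

theorem continuous_iterate_H (d : ℕ) (a : Fin (m + 1) → ℂ) (n : ℕ) : Continuous (H d a)^[n] :=
  (continuous_H d a).iterate n

/-- A compact family of points of the basin enters `V⁺` after a uniform time. -/
theorem exists_forall_iterate_mem_Vplus (hd : 2 ≤ d) (hR : 2 * coeffBound a + 3 ≤ R)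
    {X : Type*} [TopologicalSpace X] [CompactSpace X] {f : X → Uplus d a} (hf : Continuous f) :
    ∃ N, ∀ n, N ≤ n → ∀ x, (H d a)^[n] (f x) ∈ Vplus m R := by
  have hcov := isCompact_univ.elim_directed_cover (X := X)
    (fun n : ℕ => {x | (H d a)^[n] (f x : Fin (m + 2) → ℂ) ∈ Vplus m R})
    (fun n => (isOpen_Vplus m R).preimage
      ((continuous_iterate_H d a n).comp (continuous_subtype_val.comp hf)))
    (fun x _ => Set.mem_iUnion.2 (exists_iterate_mem_Vplus (f x).2 R))
    (directed_of_isDirected_le fun _ _ hkn _ hx => iterate_mem_Vplus_of_le hd hR hkn hx)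
  obtain ⟨N, hN⟩ := hcov
  exact ⟨N, fun n hn x => iterate_mem_Vplus_of_le hd hR hn (hN (Set.mem_univ x))⟩

end Basin

/-! ### The inverse automorphism -/

/-- The inverse of `H`. -/
def Hinv (d : ℕ) (a : Fin (m + 1) → ℂ) (y : Fin (m + 2) → ℂ) : Fin (m + 2) → ℂ :=
  Fin.cons (y (Fin.last _)) (Fin.cons
    ((y 0 - y (Fin.last _) ^ d - ∑ i : Fin m, a i.succ * y i.castSucc.succ) / a 0)
    (fun i : Fin m => y i.castSucc.succ))

theorem continuous_Hinv (d : ℕ) (a : Fin (m + 1) → ℂ) : Continuous (Hinv d a) := by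
  refine continuous_pi fun i => Fin.cases ?_ (fun j => Fin.cases ?_ (fun l => ?_) j) i
  · simp only [Hinv, Fin.cons_zero]; fun_prop
  · simp only [Hinv, Fin.cons_zero, Fin.cons_succ]; fun_prop
  · simp only [Hinv, Fin.cons_succ]; fun_prop

theorem castSucc_succ_succ (i : Fin m) : i.castSucc.succ + 1 = i.succ.succ := by
  rw [← Fin.castSucc_succ, Fin.coeSucc_eq_succ]

theorem Hinv_H (d : ℕ) {a : Fin (m + 1) → ℂ} (ha : a 0 ≠ 0) (z : Fin (m + 2) → ℂ) :
    Hinv d a (H d a z) = z := by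
  -- The index wraps around modulo `m + 2`, so the last coordinate of `H(z)` is `z₁`.
  have hlast : H d a z (Fin.last _) = z 0 := by
    rw [← Fin.succ_last, H_succ, Fin.succ_last, Fin.last_add_one]
  have hmid : ∀ i : Fin m, H d a z i.castSucc.succ = z i.succ.succ := fun i => by
    rw [H_succ, castSucc_succ_succ]
  funext i
  refine Fin.cases ?_ (fun j => Fin.cases ?_ (fun l => ?_) j) i
  · simp only [Hinv, Fin.cons_zero, hlast]
  · simp only [Hinv, Fin.cons_zero, Fin.cons_succ, hlast, hmid, H_zero, linPart,
      Fin.sum_univ_succ (n := m)]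
    field_simp
    ring
  · simp only [Hinv, Fin.cons_succ, hmid]

theorem H_Hinv (d : ℕ) {a : Fin (m + 1) → ℂ} (ha : a 0 ≠ 0) (y : Fin (m + 2) → ℂ) :
    H d a (Hinv d a y) = y := by
  funext i
  refine Fin.cases ?_ (fun j => Fin.lastCases ?_ (fun l => ?_) j) i
  · simp only [H_zero, linPart, Fin.sum_univ_succ (n := m), Hinv, Fin.cons_zero, Fin.cons_succ]
    field_simp
    ring
  · rw [H_succ, Fin.succ_last, Fin.last_add_one]
    simp only [Hinv, Fin.cons_zero]
  · rw [H_succ, castSucc_succ_succ]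
    simp only [Hinv, Fin.cons_succ]

/-! ### The function `φ` and the form `ω` -/

theorem differentiable_H (d : ℕ) (a : Fin (m + 1) → ℂ) : Differentiable ℂ (H d a) := by
  refine differentiable_pi.2 fun i => ?_
  refine Fin.cases ?_ (fun j => ?_) i
  · simp only [H_zero, linPart]; fun_prop
  · simp only [H_succ]; fun_prop

theorem differentiable_iterate_H (d : ℕ) (a : Fin (m + 1) → ℂ) (n : ℕ) :
    Differentiable ℂ (H d a)^[n] :=
  (differentiable_H d a).iterate n

/-- The exponent `∑ d⁻⁽ⁿ⁺¹⁾ β(Hⁿ(z))` in the definition of `φ`. -/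
def phiExponent (d : ℕ) (a : Fin (m + 1) → ℂ) (z : Fin (m + 2) → ℂ) : ℂ :=
  ∑' n : ℕ, beta d a ((H d a)^[n] z) / (d : ℂ) ^ (n + 1)

theorem phi_eq (d : ℕ) (a : Fin (m + 1) → ℂ) (z : Fin (m + 2) → ℂ) :
    phi d a z = z 0 * Complex.exp (phiExponent d a z) := rfl

section Phi

variable {d : ℕ} {a : Fin (m + 1) → ℂ} {R : ℝ} {z : Fin (m + 2) → ℂ}

theorem apply_zero_ne_zero (hR : 2 * coeffBound a + 3 ≤ R) (hz : z ∈ Vplus m R) : z 0 ≠ 0 := by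
  have := coeffBound_nonneg a
  exact norm_pos_iff.1 (by linarith [hz.1])

theorem norm_linPart_div_le (hd : 2 ≤ d) (hR : 2 * coeffBound a + 3 ≤ R) (hz : z ∈ Vplus m R) :
    ‖linPart a z / z 0 ^ d‖ ≤ 1 / 2 := by
  have hA := coeffBound_nonneg a
  have h1 : ‖z 0‖ ^ 2 ≤ ‖z 0‖ ^ d := pow_le_pow_right₀ (by linarith [hz.1]) hd
  have h2 := norm_linPart_le a fun j => (hz.2 j).le
  have h3 := hz.1
  have h4 : 0 < ‖z 0‖ := by linarith
  rw [norm_div, norm_pow, div_le_iff₀ (by positivity)]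
  nlinarith

theorem one_add_mem_slitPlane (hd : 2 ≤ d) (hR : 2 * coeffBound a + 3 ≤ R)
    (hz : z ∈ Vplus m R) : 1 + linPart a z / z 0 ^ d ∈ Complex.slitPlane := by
  refine Complex.mem_slitPlane_of_norm_lt_one ?_
  linarith [norm_linPart_div_le hd hR hz]

theorem norm_beta_le (hd : 2 ≤ d) (hR : 2 * coeffBound a + 3 ≤ R) (hz : z ∈ Vplus m R) :
    ‖beta d a z‖ ≤ 1 := by
  have h := norm_linPart_div_le hd hR hz
  have := Complex.norm_log_one_add_half_le_self h
  rw [beta]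
  linarith

theorem differentiableAt_beta (hd : 2 ≤ d) (hR : 2 * coeffBound a + 3 ≤ R)
    (hz : z ∈ Vplus m R) : DifferentiableAt ℂ (beta d a) z := by
  refine DifferentiableAt.clog ?_ (one_add_mem_slitPlane hd hR hz)
  have h0 : z 0 ^ d ≠ 0 := pow_ne_zero _ (apply_zero_ne_zero hR hz)
  unfold linPart
  fun_prop (disch := assumption)

theorem H_zero_eq_mul_exp_beta (hd : 2 ≤ d) (hR : 2 * coeffBound a + 3 ≤ R)
    (hz : z ∈ Vplus m R) : H d a z 0 = z 0 ^ d * Complex.exp (beta d a z) := by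
  have h0 := apply_zero_ne_zero hR hz
  rw [beta, Complex.exp_log (Complex.slitPlane_ne_zero (one_add_mem_slitPlane hd hR hz)), H_zero]
  field_simp

theorem norm_exponent_term_le (hd : 2 ≤ d) (hR : 2 * coeffBound a + 3 ≤ R)
    (hz : z ∈ Vplus m R) (n : ℕ) :
    ‖beta d a ((H d a)^[n] z) / (d : ℂ) ^ (n + 1)‖ ≤ (1 / 2 : ℝ) ^ n := by
  have h1 := norm_beta_le hd hR (iterate_mem_Vplus hd hR hz n)
  have hd' : (2 : ℝ) ≤ d := by exact_mod_cast hd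
  have h2 : (2 : ℝ) ^ n ≤ (d : ℝ) ^ (n + 1) :=
    (pow_le_pow_left₀ (by norm_num) hd' n).trans (pow_le_pow_right₀ (by linarith) n.le_succ)
  rw [norm_div, norm_pow, Complex.norm_natCast, one_div, inv_pow, ← one_div]
  exact div_le_div₀ zero_le_one h1 (by positivity) h2

theorem summable_exponent (hd : 2 ≤ d) (hR : 2 * coeffBound a + 3 ≤ R) (hz : z ∈ Vplus m R) :
    Summable fun n : ℕ => beta d a ((H d a)^[n] z) / (d : ℂ) ^ (n + 1) :=
  .of_norm_bounded summable_geometric_two fun n => norm_exponent_term_le hd hR hz n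

theorem differentiableAt_exponent_term (hd : 2 ≤ d) (hR : 2 * coeffBound a + 3 ≤ R)
    (hz : z ∈ Vplus m R) (n : ℕ) :
    DifferentiableAt ℂ (fun z => beta d a ((H d a)^[n] z) / (d : ℂ) ^ (n + 1)) z := by
  have h : DifferentiableAt ℂ (fun z => beta d a ((H d a)^[n] z)) z :=
    DifferentiableAt.comp z (g := beta d a) (differentiableAt_beta hd hR (iterate_mem_Vplus hd hR hz n))
      (differentiable_iterate_H d a n z)
  simpa only [div_eq_mul_inv] using h.mul_const _

/-- The series is differentiated termwise: the terms are bounded by `2⁻ⁿ` on `V⁺`, so Cauchy's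
estimate bounds their derivatives by a summable sequence near `z`. -/
theorem differentiableAt_phiExponent (hd : 2 ≤ d) (hR : 2 * coeffBound a + 3 ≤ R)
    (hz : z ∈ Vplus m R) : DifferentiableAt ℂ (phiExponent d a) z := by
  obtain ⟨ε, hε, hball⟩ := Metric.isOpen_iff.1 (isOpen_Vplus m R) z hz
  -- Halving the radius leaves a ball of radius `ε / 2` inside `V⁺` around every `w` near `z`, as
  -- Cauchy's estimate at `w` requires.
  have hV {w v} (hw : w ∈ Metric.ball z (ε / 2)) (hv : v ∈ Metric.ball w (ε / 2)) :
      v ∈ Vplus m R := by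
    refine hball (Metric.mem_ball.2 ?_)
    have := dist_triangle v w z
    rw [Metric.mem_ball] at hw hv
    linarith
  have hz0 : z ∈ Metric.ball z (ε / 2) := Metric.mem_ball_self (half_pos hε)
  refine (hasFDerivAt_tsum_of_isPreconnected (𝕜 := ℂ)
    (f := fun (n : ℕ) z => beta d a ((H d a)^[n] z) / (d : ℂ) ^ (n + 1))
    (u := fun n => (2 * (1 / 2 : ℝ) ^ n) / (ε / 2))
    ((summable_geometric_two.mul_left 2).div_const _) Metric.isOpen_ball
    (convex_ball z (ε / 2)).isPreconnected (fun n w hw => (differentiableAt_exponent_term hd hR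
      (hV hw (Metric.mem_ball_self (half_pos hε))) n).hasFDerivAt) (fun n w hw => ?_) hz0
    (summable_exponent hd hR hz) hz0).differentiableAt
  refine Complex.norm_fderiv_le_div_of_mapsTo_ball (fun v hv =>
    (differentiableAt_exponent_term hd hR (hV hw hv) n).differentiableWithinAt)
    (fun v hv => ?_) (half_pos hε)
  have h1 := norm_exponent_term_le hd hR (hV hw hv) n
  have h2 := norm_exponent_term_le hd hR (hV hw (Metric.mem_ball_self (half_pos hε))) n
  rw [mem_closedBall_iff_norm]
  refine (norm_sub_le _ _).trans ?_
  linarith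

/-- Splitting off the term `n = 0` and multiplying by `d` shifts the series by one iterate.
Exponentiated, this is `φ ∘ H = φ^d`. -/
theorem phiExponent_H (hd : 2 ≤ d) (hR : 2 * coeffBound a + 3 ≤ R) (hz : z ∈ Vplus m R) :
    beta d a z + phiExponent d a (H d a z) = d * phiExponent d a z := by
  have hd0 : (d : ℂ) ≠ 0 := by exact_mod_cast (by omega : d ≠ 0)
  rw [phiExponent, phiExponent, (summable_exponent hd hR hz).tsum_eq_zero_add, mul_add,
    ← tsum_mul_left]
  congr 1
  · simp only [Function.iterate_zero, id_eq, zero_add, pow_one]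
    field_simp
  · refine tsum_congr fun n => ?_
    rw [Function.iterate_succ_apply, pow_succ _ (n + 1)]
    field_simp

theorem phi_H (hd : 2 ≤ d) (hR : 2 * coeffBound a + 3 ≤ R) (hz : z ∈ Vplus m R) :
    phi d a (H d a z) = phi d a z ^ d := by
  rw [phi_eq, phi_eq, mul_pow, ← Complex.exp_nat_mul, ← phiExponent_H hd hR hz, Complex.exp_add,
    H_zero_eq_mul_exp_beta hd hR hz]
  ring

theorem phi_ne_zero (hR : 2 * coeffBound a + 3 ≤ R) (hz : z ∈ Vplus m R) : phi d a z ≠ 0 :=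
  mul_ne_zero (apply_zero_ne_zero hR hz) (Complex.exp_ne_zero _)

theorem differentiableAt_phi (hd : 2 ≤ d) (hR : 2 * coeffBound a + 3 ≤ R)
    (hz : z ∈ Vplus m R) : DifferentiableAt ℂ (phi d a) z :=
  DifferentiableAt.mul (by fun_prop) (differentiableAt_phiExponent hd hR hz).cexp

/-- Logarithmic differentiation of `φ ∘ H = φ^d`, which holds near `z` because `V⁺` is open. -/
theorem dlogPhi_comp_fderiv_H (hd : 2 ≤ d) (hR : 2 * coeffBound a + 3 ≤ R)
    (hz : z ∈ Vplus m R) :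
    (dlogPhi d a (H d a z)).comp (fderiv ℂ (H d a) z) = (d : ℂ) • dlogPhi d a z := by
  have h1 : fderiv ℂ (phi d a ∘ H d a) z = fderiv ℂ (fun w => phi d a w ^ d) z := by
    refine Filter.EventuallyEq.fderiv_eq ?_
    filter_upwards [(isOpen_Vplus m R).mem_nhds hz] with w hw
    exact phi_H hd hR hw
  rw [fderiv_comp z (differentiableAt_phi hd hR (H_mem_Vplus hd hR hz)) (differentiable_H d a z),
    fderiv_fun_pow _ (differentiableAt_phi hd hR hz)] at h1
  have h0 := phi_ne_zero (d := d) hR hz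
  rw [dlogPhi, dlogPhi, ContinuousLinearMap.smul_comp, h1, phi_H hd hR hz, smul_smul, smul_smul]
  congr 1
  obtain ⟨e, rfl⟩ : ∃ e, d = e + 1 := ⟨d - 1, by omega⟩
  simp only [Nat.add_sub_cancel, nsmul_eq_mul, pow_succ]
  field_simp

theorem dlogPhi_comp_fderiv_iterate (hd : 2 ≤ d) (hR : 2 * coeffBound a + 3 ≤ R)
    (hz : z ∈ Vplus m R) (n : ℕ) :
    (dlogPhi d a ((H d a)^[n] z)).comp (fderiv ℂ (H d a)^[n] z) =
      (d : ℂ) ^ n • dlogPhi d a z := by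
  induction n with
  | zero =>
    simp only [Function.iterate_zero, id_eq, fderiv_id, pow_zero, one_smul]
    exact ContinuousLinearMap.comp_id _
  | succ n ih =>
    rw [Function.iterate_succ', Function.comp_apply, fderiv_comp z (differentiable_H d a _)
      (differentiable_iterate_H d a n z), ← ContinuousLinearMap.comp_assoc,
      dlogPhi_comp_fderiv_H hd hR (iterate_mem_Vplus hd hR hz n), ContinuousLinearMap.smul_comp,
      ih, smul_smul, pow_succ']

/-- The value of `ω` at a point of `H⁻ⁿ(V⁺)` can be computed with `n`. -/
theorem omega_eq (hd : 2 ≤ d) (hR : 2 * coeffBound a + 3 ≤ R) {n : ℕ}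
    (hz : (H d a)^[n] z ∈ Vplus m R) :
    omega d a R z = ((d : ℂ) ^ n)⁻¹ •
      (dlogPhi d a ((H d a)^[n] z)).comp (fderiv ℂ (H d a)^[n] z) := by
  classical
  have hd0 : (d : ℂ) ≠ 0 := by exact_mod_cast (by omega : d ≠ 0)
  have hex : ∃ n : ℕ, (H d a)^[n] z ∈ Vplus m R := ⟨n, hz⟩
  rw [omega, dif_pos hex]
  have hk := Nat.find_spec hex
  have hkn := Nat.find_min' hex hz
  generalize Nat.find hex = k at hk hkn
  -- With `k` the least entry time, the `j` further iterates stay in `V⁺` and contribute a factor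
  -- `d^j` that the normalization cancels.
  obtain ⟨j, rfl⟩ := Nat.exists_eq_add_of_le' hkn
  rw [Function.iterate_add (H d a) j k, Function.comp_apply,
    fderiv_comp z (differentiable_iterate_H d a j _) (differentiable_iterate_H d a k z),
    ← ContinuousLinearMap.comp_assoc, dlogPhi_comp_fderiv_iterate hd hR hk,
    ContinuousLinearMap.smul_comp, smul_smul]
  congr 1
  rw [pow_add]
  field_simp

/-- A local primitive of `dφ/φ`. -/
theorem hasFDerivAt_log_add_phiExponent (hd : 2 ≤ d) (hR : 2 * coeffBound a + 3 ≤ R)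
    (hz : z ∈ Vplus m R) {c : ℂ} (hc : c ≠ 0) (hzc : z 0 / c ∈ Complex.slitPlane) :
    HasFDerivAt (fun w : Fin (m + 2) → ℂ => Complex.log (w 0 / c) + phiExponent d a w)
      (dlogPhi d a z) z := by
  have h0 := apply_zero_ne_zero hR hz
  have hp : HasFDerivAt (fun w : Fin (m + 2) → ℂ => w 0)
      (ContinuousLinearMap.proj (R := ℂ) (φ := fun _ : Fin (m + 2) => ℂ) 0) z :=
    hasFDerivAt_apply 0 z
  have hg := (differentiableAt_phiExponent hd hR hz).hasFDerivAt
  have hphi : HasFDerivAt (phi d a) _ z := hp.mul hg.cexp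
  have hq := hp.mul_const c⁻¹
  simp only [← div_eq_mul_inv] at hq
  refine ((hq.clog hzc).add hg).congr_fderiv ?_
  rw [dlogPhi, hphi.fderiv, phi_eq]
  have he := Complex.exp_ne_zero (phiExponent d a z)
  ext v
  simp only [smul_apply, add_apply, smul_eq_mul]
  rw [← phiExponent]
  field_simp
  ring

end Phi

/-! ### Integrals of `ω` along paths -/

section Integral

variable {d : ℕ} {a : Fin (m + 1) → ℂ} {R : ℝ}

/-- `L + phiExponent` is a continuous logarithm of `φ ∘ Hⁿ` along `γ`. Near `γ t` the local
primitive uses the principal logarithm of the first coordinate divided by its value at `γ t`, which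
avoids the branch cut. -/
theorem isPrimitiveAlong_omega (hd : 2 ≤ d) (hR : 2 * coeffBound a + 3 ≤ R)
    {x y : Fin (m + 2) → ℂ} (γ : Path x y) {n : ℕ} (hn : ∀ t, (H d a)^[n] (γ t) ∈ Vplus m R)
    {L : unitInterval → ℂ} (hL : Continuous L)
    (hexp : ∀ t, Complex.exp (L t) = (H d a)^[n] (γ t) 0) :
    IsPrimitiveAlong (omega d a R) γ
      (fun t => ((d : ℂ) ^ n)⁻¹ * (L t + phiExponent d a ((H d a)^[n] (γ t)))) := by
  intro t
  have hc := Complex.exp_ne_zero (L t)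
  have hcont : Continuous fun w => (H d a)^[n] w 0 / Complex.exp (L t) :=
    ((continuous_apply 0).comp (continuous_iterate_H d a n)).div_const _
  refine ⟨fun w => ((d : ℂ) ^ n)⁻¹ * (L t + (Complex.log ((H d a)^[n] w 0 / Complex.exp (L t)) +
    phiExponent d a ((H d a)^[n] w))), ?_, ?_⟩
  · have h1 : ∀ᶠ w in 𝓝 (γ t), (H d a)^[n] w 0 / Complex.exp (L t) ∈ Complex.slitPlane := by
      refine hcont.continuousAt.eventually (Complex.isOpen_slitPlane.mem_nhds ?_)
      beta_reduce
      rw [← hexp, div_self hc]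
      exact Complex.one_mem_slitPlane
    have h2 : ∀ᶠ w in 𝓝 (γ t), (H d a)^[n] w ∈ Vplus m R :=
      (continuous_iterate_H d a n).continuousAt.eventually ((isOpen_Vplus m R).mem_nhds (hn t))
    filter_upwards [h1, h2] with w hw1 hw2
    rw [omega_eq hd hR hw2]
    have := (hasFDerivAt_log_add_phiExponent hd hR hw2 hc hw1).comp w
      (differentiable_iterate_H d a n w).hasFDerivAt
    exact (this.const_add (L t)).const_mul _
  -- Within distance `π` the principal logarithm inverts `exp`, so it recovers `L s - L t`.
  · have h1 : ∀ᶠ s in 𝓝 t, L s - L t ∈ Metric.ball (0 : ℂ) Real.pi := by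
      refine (hL.sub continuous_const).continuousAt.eventually (Metric.isOpen_ball.mem_nhds ?_)
      simp only [Pi.sub_apply, sub_self]
      exact Metric.mem_ball_self Real.pi_pos
    filter_upwards [h1] with s hs
    rw [mem_ball_zero_iff] at hs
    have him := (Complex.abs_im_le_norm (L s - L t)).trans_lt hs
    rw [abs_lt] at him
    simp only [← hexp s, ← Complex.exp_sub, Complex.log_exp him.1 him.2.le]
    ring

theorem exists_log_lift (f : C(unitInterval, ℂ)) (hf : ∀ t, f t ≠ 0) :
    ∃ L : C(unitInterval, ℂ), ∀ t, Complex.exp (L t) = f t := by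
  obtain ⟨L, hL, -⟩ := Complex.isCoveringMap_exp.exists_path_lifts
    ⟨fun t => (⟨f t, hf t⟩ : {z : ℂ // z ≠ 0}), f.continuous.subtype_mk _⟩ (Complex.log (f 0))
    (Subtype.ext (Complex.exp_log (hf 0)).symm)
  exact ⟨L, fun t => congrArg Subtype.val (congrFun hL t)⟩

/-- `L` is a logarithm of the first coordinate of `Hⁿ` along the path `C`, which `Hⁿ` maps into
`V⁺`. -/
structure IsLogAlong (R : ℝ) {x y : Uplus d a} (C : Path x y) (n : ℕ)
    (L : C(unitInterval, ℂ)) : Prop where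
  mem : ∀ t, (H d a)^[n] (C t) ∈ Vplus m R
  exp_eq : ∀ t, Complex.exp (L t) = (H d a)^[n] (C t : Fin (m + 2) → ℂ) 0

theorem exists_isLogAlong_of_mem (hR : 2 * coeffBound a + 3 ≤ R)
    {x y : Uplus d a} (C : Path x y) {n : ℕ} (hn : ∀ t, (H d a)^[n] (C t) ∈ Vplus m R) :
    ∃ L, IsLogAlong R C n L := by
  obtain ⟨L, hL⟩ := exists_log_lift ⟨fun t => (H d a)^[n] (C t : Fin (m + 2) → ℂ) 0,
    (continuous_apply 0).comp ((continuous_iterate_H d a n).comp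
      (continuous_subtype_val.comp C.continuous))⟩ fun t => apply_zero_ne_zero hR (hn t)
  exact ⟨L, hn, hL⟩

theorem exists_isLogAlong (hd : 2 ≤ d) (hR : 2 * coeffBound a + 3 ≤ R)
    {x y : Uplus d a} (C : Path x y) : ∃ N, ∀ n, N ≤ n → ∃ L, IsLogAlong R C n L := by
  obtain ⟨N, hN⟩ := exists_forall_iterate_mem_Vplus hd hR C.continuous
  exact ⟨N, fun n hn => exists_isLogAlong_of_mem hR C (hN n hn)⟩

theorem formIntegrable_omega (hd : 2 ≤ d) (hR : 2 * coeffBound a + 3 ≤ R)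
    {x y : Uplus d a} (C : Path x y) : FormIntegrable (omega d a R) (ambient C) := by
  obtain ⟨N, hN⟩ := exists_isLogAlong hd hR C
  obtain ⟨L, hL⟩ := hN N le_rfl
  exact ⟨_, isPrimitiveAlong_omega hd hR (ambient C) hL.mem L.continuous hL.exp_eq⟩

/-- The curve is closed, so `phiExponent` takes the same value at both ends and cancels. -/
theorem IsLogAlong.alpha_eq (hd : 2 ≤ d) (hR : 2 * coeffBound a + 3 ≤ R)
    {x : Uplus d a} {C : Path x x} {n : ℕ} {L : C(unitInterval, ℂ)} (h : IsLogAlong R C n L) :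
    alpha R C = (L 1 - L 0) / (2 * Real.pi * Complex.I) / (d : ℂ) ^ n := by
  rw [alpha, formIntegral_eq
    (isPrimitiveAlong_omega hd hR (ambient C) h.mem L.continuous h.exp_eq)]
  rw [Path.source, Path.target]
  have hd0 : (d : ℂ) ≠ 0 := by exact_mod_cast (by omega : d ≠ 0)
  have hpi : (Real.pi : ℂ) ≠ 0 := Complex.ofReal_ne_zero.2 Real.pi_ne_zero
  field_simp
  ring

theorem IsLogAlong.exists_int {x : Uplus d a} {C : Path x x} {n : ℕ} {L : C(unitInterval, ℂ)}
    (h : IsLogAlong R C n L) : ∃ j : ℤ, L 1 - L 0 = j * (2 * Real.pi * Complex.I) := by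
  have he : Complex.exp (L 1) = Complex.exp (L 0) := by
    rw [h.exp_eq, h.exp_eq, C.source, C.target]
  obtain ⟨j, hj⟩ := Complex.exp_eq_exp_iff_exists_int.1 he
  exact ⟨j, by rw [hj]; ring⟩

/-- The source of the factor `d` in (1): one logarithm serves `H(C)` at time `n` and `C` at time `n
+ 1`. -/
theorem IsLogAlong.of_map_HU {x y : Uplus d a} {C : Path x y} {n : ℕ} {L : C(unitInterval, ℂ)}
    (h : IsLogAlong R (C.map (continuous_HU d a)) n L) : IsLogAlong R C (n + 1) L :=
  ⟨h.mem, h.exp_eq⟩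

theorem alpha_map_HU (hd : 2 ≤ d) (hR : 2 * coeffBound a + 3 ≤ R)
    {x : Uplus d a} (C : Path x x) :
    alpha R (C.map (continuous_HU d a)) = d * alpha R C := by
  obtain ⟨N, hN⟩ := exists_isLogAlong hd hR (C.map (continuous_HU d a))
  obtain ⟨L, hL⟩ := hN N le_rfl
  have hd0 : (d : ℂ) ≠ 0 := by exact_mod_cast (by omega : d ≠ 0)
  rw [hL.alpha_eq hd hR, hL.of_map_HU.alpha_eq hd hR, pow_succ]
  field_simp

/-! ### Values in `ℤ[1/d]`, additivity and homotopy invariance -/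

theorem int_div_pow_mem_ZInv (d : ℕ) (j : ℤ) (n : ℕ) : (j : ℂ) / (d : ℂ) ^ n ∈ ZInv d := by
  rw [div_eq_mul_one_div, ← one_div_pow]
  have h1 : 1 / (d : ℂ) ∈ ZInv d := Algebra.subset_adjoin rfl
  have h2 : (j : ℂ) ∈ ZInv d := intCast_mem (ZInv d) j
  exact (ZInv d).mul_mem h2 ((ZInv d).pow_mem h1 n)

/-- All large exponents are allowed, so that `n` can also be chosen with `Hⁿ(x)` in `V⁺`. -/
theorem exists_eq_div_pow_of_mem_ZInv (hd : 2 ≤ d) {r : ℂ} (hr : r ∈ ZInv d) :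
    ∃ N : ℕ, ∀ n, N ≤ n → ∃ j : ℤ, r = j / (d : ℂ) ^ n := by
  have hd0 : (d : ℂ) ≠ 0 := by exact_mod_cast (by omega : d ≠ 0)
  suffices ∃ (N : ℕ) (j : ℤ), r = j / (d : ℂ) ^ N by
    obtain ⟨N, j, rfl⟩ := this
    refine ⟨N, fun n hn => ?_⟩
    obtain ⟨k, rfl⟩ := Nat.exists_eq_add_of_le hn
    refine ⟨j * d ^ k, ?_⟩
    push_cast
    rw [pow_add]
    field_simp
  induction hr using Algebra.adjoin_induction with
  | mem x hx =>
    rw [Set.mem_singleton_iff.1 hx]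
    exact ⟨1, 1, by simp⟩
  | algebraMap j => exact ⟨0, j, by simp⟩
  | add x y _ _ hx hy =>
    obtain ⟨N, j, rfl⟩ := hx
    obtain ⟨M, k, rfl⟩ := hy
    refine ⟨N + M, j * d ^ M + k * d ^ N, ?_⟩
    push_cast
    rw [pow_add]
    field_simp
  | mul x y _ _ hx hy =>
    obtain ⟨N, j, rfl⟩ := hx
    obtain ⟨M, k, rfl⟩ := hy
    refine ⟨N + M, j * k, ?_⟩
    push_cast
    rw [pow_add]
    field_simp

theorem alpha_mem_ZInv (hd : 2 ≤ d) (hR : 2 * coeffBound a + 3 ≤ R)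
    {x : Uplus d a} (C : Path x x) : alpha R C ∈ ZInv d := by
  obtain ⟨N, hN⟩ := exists_isLogAlong hd hR C
  obtain ⟨L, hL⟩ := hN N le_rfl
  obtain ⟨j, hj⟩ := hL.exists_int
  rw [hL.alpha_eq hd hR, hj, mul_div_cancel_right₀ _ Complex.two_pi_I_ne_zero]
  exact int_div_pow_mem_ZInv d j N

theorem alpha_trans (hd : 2 ≤ d) (hR : 2 * coeffBound a + 3 ≤ R)
    {x : Uplus d a} (C C' : Path x x) : alpha R (C.trans C') = alpha R C + alpha R C' := by
  obtain ⟨N, hN⟩ := exists_isLogAlong hd hR C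
  obtain ⟨M, hM⟩ := exists_isLogAlong hd hR C'
  obtain ⟨L, hL⟩ := hN (max N M) (le_max_left _ _)
  obtain ⟨L', hL'⟩ := hM (max N M) (le_max_right _ _)
  generalize max N M = n at hL hL'
  let P : Path (L 0) (L 1) := ⟨L, rfl, rfl⟩
  -- The second logarithm is translated to start where the first ends. By `he` the translation is a
  -- period of `exp`.
  let P' : Path (L 1) (L' 1 + (L 1 - L' 0)) :=
    ⟨⟨fun t => L' t + (L 1 - L' 0), by fun_prop⟩, by simp, rfl⟩
  have he : Complex.exp (L 1 - L' 0) = 1 := by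
    rw [Complex.exp_sub, hL.exp_eq, hL'.exp_eq, C.target, C'.source,
      div_self (apply_zero_ne_zero hR (by simpa using hL.mem 0))]
  have h : IsLogAlong R (C.trans C') n (P.trans P').toContinuousMap := by
    refine ⟨fun t => ?_, fun t => ?_⟩
    · rw [Path.trans_apply]
      split_ifs
      exacts [hL.mem _, hL'.mem _]
    · change Complex.exp ((P.trans P') t) = _
      rw [Path.trans_apply, Path.trans_apply]
      split_ifs
      · exact hL.exp_eq _
      · change Complex.exp (L' _ + (L 1 - L' 0)) = _
        rw [Complex.exp_add, he, mul_one]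
        exact hL'.exp_eq _
  have h0 : (P.trans P').toContinuousMap 0 = L 0 := (P.trans P').source
  have h1 : (P.trans P').toContinuousMap 1 = L' 1 + (L 1 - L' 0) := (P.trans P').target
  rw [h.alpha_eq hd hR, hL.alpha_eq hd hR, hL'.alpha_eq hd hR, h0, h1]
  ring

/-- By compactness one `Hⁿ` carries the whole homotopy into `V⁺`. Its first coordinate is then a
homotopy in `ℂ \ {0}` with fixed ends, and lifts through the covering `exp` from a common start have
a common end. -/
theorem alpha_eq_of_homotopic (hd : 2 ≤ d) (hR : 2 * coeffBound a + 3 ≤ R)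
    {x : Uplus d a} {C C' : Path x x} (h : Path.Homotopic C C') : alpha R C = alpha R C' := by
  obtain ⟨F⟩ := h
  obtain ⟨n, hn⟩ := exists_forall_iterate_mem_Vplus (R := R) hd hR (map_continuous F)
  replace hn := hn n le_rfl
  have h0 : ∀ t, (H d a)^[n] (C t) ∈ Vplus m R := fun t => F.apply_zero t ▸ hn (0, t)
  have h1 : ∀ t, (H d a)^[n] (C' t) ∈ Vplus m R := fun t => F.apply_one t ▸ hn (1, t)
  let V := {w : Uplus d a // (H d a)^[n] (w : Fin (m + 2) → ℂ) ∈ Vplus m R}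
  let q : C(V, {z : ℂ // z ≠ 0}) := ⟨fun w => ⟨(H d a)^[n] (w.1 : Fin (m + 2) → ℂ) 0,
    apply_zero_ne_zero hR w.2⟩, ((continuous_apply 0).comp ((continuous_iterate_H d a n).comp
      (continuous_subtype_val.comp continuous_subtype_val))).subtype_mk _⟩
  let D : C(unitInterval, V) := ⟨fun t => ⟨C t, h0 t⟩, C.continuous.subtype_mk _⟩
  let D' : C(unitInterval, V) := ⟨fun t => ⟨C' t, h1 t⟩, C'.continuous.subtype_mk _⟩
  have hDD' : D.HomotopicRel D' {0, 1} :=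
    ⟨{ toFun := fun p => ⟨F p, hn p⟩
       continuous_toFun := (map_continuous F).subtype_mk _
       map_zero_left := fun t => Subtype.ext (F.apply_zero t)
       map_one_left := fun t => Subtype.ext (F.apply_one t)
       prop' := fun s t ht => Subtype.ext (F.prop' s t ht) }⟩
  obtain ⟨L, hL⟩ := exists_isLogAlong_of_mem hR C h0
  have hs : q.comp D 0 = ⟨_, Complex.exp_ne_zero (L 0)⟩ := Subtype.ext (hL.exp_eq 0).symm
  have hs' : q.comp D' 0 = ⟨_, Complex.exp_ne_zero (L 0)⟩ := by
    refine Subtype.ext ?_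
    change (H d a)^[n] (C' 0 : Fin (m + 2) → ℂ) 0 = Complex.exp (L 0)
    rw [hL.exp_eq 0, C.source, C'.source]
  have key := Complex.isCoveringMap_exp.liftPath_apply_one_eq_of_homotopicRel
    (hDD'.comp_continuousMap q) (L 0) hs hs'
  have hlog : ∀ (E : Path x x) (hE : ∀ t, (H d a)^[n] (E t) ∈ Vplus m R)
      (hE0 : q.comp ⟨fun t => ⟨E t, hE t⟩, E.continuous.subtype_mk _⟩ 0 =
        ⟨_, Complex.exp_ne_zero (L 0)⟩),
      IsLogAlong R E n (Complex.isCoveringMap_exp.liftPath _ (L 0) hE0) := fun E hE hE0 =>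
    ⟨hE, fun t => congrArg Subtype.val
      (congrFun (Complex.isCoveringMap_exp.liftPath_lifts _ (L 0) hE0) t)⟩
  rw [(hlog C h0 hs).alpha_eq hd hR, (hlog C' h1 hs').alpha_eq hd hR,
    Complex.isCoveringMap_exp.liftPath_zero, Complex.isCoveringMap_exp.liftPath_zero]
  congr 3

theorem alpha_refl (hd : 2 ≤ d) (hR : 2 * coeffBound a + 3 ≤ R) (x : Uplus d a) :
    alpha R (Path.refl x) = 0 := by
  obtain ⟨n, hn⟩ := exists_iterate_mem_Vplus x.2 R
  have h : IsLogAlong R (Path.refl x) n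
      (ContinuousMap.const _ (Complex.log ((H d a)^[n] (x : Fin (m + 2) → ℂ) 0))) :=
    ⟨fun _ => hn, fun _ => Complex.exp_log (apply_zero_ne_zero hR hn)⟩
  rw [h.alpha_eq hd hR]
  simp

end Integral

/-! ### A convex parametrization of `V⁺` and its preimages -/

/-- The map `(L, u) ↦ (e^L, e^L u₁, …)`, the universal covering of `V⁺` when restricted to
`polarDomain`. -/
def polar (q : ℂ × (Fin (m + 1) → ℂ)) : Fin (m + 2) → ℂ :=
  Fin.cons (Complex.exp q.1) (fun j => Complex.exp q.1 * q.2 j)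

/-- The convex set of all `(L, u)` with `Re L > log R` and `|u_j| < 1`. -/
def polarDomain (m : ℕ) (R : ℝ) : Set (ℂ × (Fin (m + 1) → ℂ)) :=
  {q | Real.log R < q.1.re ∧ ∀ j, ‖q.2 j‖ < 1}

theorem continuous_polar : Continuous (polar (m := m)) := by
  refine continuous_pi fun i => Fin.cases ?_ (fun j => ?_) i
  · simp only [polar, Fin.cons_zero]; fun_prop
  · simp only [polar, Fin.cons_succ]; fun_prop

theorem convex_polarDomain (m : ℕ) (R : ℝ) : Convex ℝ (polarDomain m R) := by
  have h1 : Convex ℝ {q : ℂ × (Fin (m + 1) → ℂ) | Real.log R < q.1.re} :=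
    ((convex_halfSpace_re_gt (Real.log R)).is_linear_preimage
      (f := (Prod.fst : ℂ × (Fin (m + 1) → ℂ) → ℂ)) ⟨fun _ _ => rfl, fun _ _ => rfl⟩)
  have h2 : ∀ j, Convex ℝ {q : ℂ × (Fin (m + 1) → ℂ) | ‖q.2 j‖ < 1} := fun j => by
    have h := (convex_ball (0 : ℂ) 1).is_linear_preimage
      (f := fun q : ℂ × (Fin (m + 1) → ℂ) => q.2 j) ⟨fun _ _ => rfl, fun _ _ => rfl⟩
    simpa only [Set.preimage, mem_ball_zero_iff] using h
  have : polarDomain m R = {q | Real.log R < q.1.re} ∩ ⋂ j, {q | ‖q.2 j‖ < 1} := by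
    ext q; simp [polarDomain]
  rw [this]
  exact h1.inter (convex_iInter h2)

theorem polar_mem_Vplus {R : ℝ} (hR : 0 < R) {q : ℂ × (Fin (m + 1) → ℂ)}
    (hq : q ∈ polarDomain m R) : polar q ∈ Vplus m R := by
  have h0 := norm_pos_iff.2 (Complex.exp_ne_zero q.1)
  refine ⟨?_, fun j => ?_⟩
  · simp only [polar, Fin.cons_zero, Complex.norm_exp]
    exact (Real.log_lt_iff_lt_exp hR).1 hq.1
  · simp only [polar, Fin.cons_zero, Fin.cons_succ, norm_mul]
    exact mul_lt_of_lt_one_right h0 (hq.2 j)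

theorem polar_eq {z : Fin (m + 2) → ℂ} {L : ℂ} (hL : Complex.exp L = z 0) :
    polar (L, fun j => z j.succ / z 0) = z := by
  have h0 : z 0 ≠ 0 := hL ▸ Complex.exp_ne_zero L
  refine funext fun i => Fin.cases ?_ (fun j => ?_) i
  · simpa only [polar, Fin.cons_zero] using hL
  · simp only [polar, Fin.cons_succ, hL]
    field_simp

theorem mem_polarDomain {R : ℝ} (hR : 0 < R) {z : Fin (m + 2) → ℂ} (hz : z ∈ Vplus m R) {L : ℂ}
    (hL : Complex.exp L = z 0) : (L, fun j => z j.succ / z 0) ∈ polarDomain m R := by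
  have h0 : 0 < ‖z 0‖ := hR.trans hz.1
  refine ⟨?_, fun j => ?_⟩
  · rw [Real.log_lt_iff_lt_exp hR, ← Complex.norm_exp, hL]
    exact hz.1
  · simp only [norm_div]
    exact (div_lt_one h0).2 (hz.2 j)

section Covering

variable {d : ℕ} {a : Fin (m + 1) → ℂ} {R : ℝ}

/-- The map `H⁻ⁿ ∘ polar` from `polarDomain` onto `H⁻ⁿ(V⁺)`. -/
def basinPolar (hd : 2 ≤ d) (ha : a 0 ≠ 0) (hR : 2 * coeffBound a + 3 ≤ R) (n : ℕ)
    (q : polarDomain m R) : Uplus d a :=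
  ⟨(Hinv d a)^[n] (polar q.1), by
    refine mem_Uplus_of_iterate_mem n ?_
    rw [Function.LeftInverse.iterate (H_Hinv d ha) n]
    exact Vplus_subset_Uplus hd hR
      (polar_mem_Vplus (by linarith [coeffBound_nonneg a]) q.2)⟩

theorem continuous_basinPolar (hd : 2 ≤ d) (ha : a 0 ≠ 0) (hR : 2 * coeffBound a + 3 ≤ R)
    (n : ℕ) : Continuous (basinPolar hd ha hR n) :=
  (((continuous_Hinv d a).iterate n).comp
    (continuous_polar.comp continuous_subtype_val)).subtype_mk _

theorem iterate_basinPolar (hd : 2 ≤ d) (ha : a 0 ≠ 0) (hR : 2 * coeffBound a + 3 ≤ R)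
    (n : ℕ) (q : polarDomain m R) :
    (H d a)^[n] (basinPolar hd ha hR n q) = polar q.1 :=
  Function.LeftInverse.iterate (H_Hinv d ha) n _

theorem eq_basinPolar (hd : 2 ≤ d) (ha : a 0 ≠ 0) (hR : 2 * coeffBound a + 3 ≤ R) {n : ℕ}
    {w : Uplus d a} {q : polarDomain m R} (h : polar q.1 = (H d a)^[n] w) :
    basinPolar hd ha hR n q = w := by
  refine Subtype.ext ?_
  change (Hinv d a)^[n] (polar q.1) = w
  rw [h]
  exact Function.LeftInverse.iterate (Hinv_H d ha) n _

instance pathConnectedSpace_polarDomain (m : ℕ) (R : ℝ) :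
    PathConnectedSpace (polarDomain m R) := by
  refine isPathConnected_iff_pathConnectedSpace.1 ((convex_polarDomain m R).isPathConnected ?_)
  exact ⟨((Real.log R + 1 : ℝ), 0), by simp [polarDomain]⟩

/-- Any two points lie in a common `H⁻ⁿ(V⁺)`, the continuous image of a convex set. -/
theorem pathConnectedSpace_Uplus (hd : 2 ≤ d) (ha : a 0 ≠ 0) :
    PathConnectedSpace (Uplus d a) := by
  have hR := le_refl (2 * coeffBound a + 3)
  have hR0 : 0 < 2 * coeffBound a + 3 := by linarith [coeffBound_nonneg a]
  have hcov : ∀ (w : Uplus d a) (n : ℕ), (H d a)^[n] w ∈ Vplus m (2 * coeffBound a + 3) →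
      ∃ q, basinPolar hd ha hR n q = w := fun w n hn => by
    have hL := Complex.exp_log (apply_zero_ne_zero hR hn)
    exact ⟨⟨_, mem_polarDomain hR0 hn hL⟩, eq_basinPolar hd ha hR (polar_eq hL)⟩
  refine ⟨⟨basinPolar hd ha hR 0 (Classical.arbitrary _)⟩, fun x y => ?_⟩
  obtain ⟨N, hN⟩ := exists_iterate_mem_Vplus x.2 (2 * coeffBound a + 3)
  obtain ⟨M, hM⟩ := exists_iterate_mem_Vplus y.2 (2 * coeffBound a + 3)
  obtain ⟨p, rfl⟩ := hcov x (max N M) (iterate_mem_Vplus_of_le hd hR (le_max_left _ _) hN)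
  obtain ⟨q, rfl⟩ := hcov y (max N M) (iterate_mem_Vplus_of_le hd hR (le_max_right _ _) hM)
  exact (PathConnectedSpace.joined p q).map (continuous_basinPolar hd ha hR _)

/-- Vanishing of `α` makes the logarithm close up, so the curve lifts to a loop in the convex set
`polarDomain`. The straight-line contraction of that loop is pushed down by `basinPolar`. -/
theorem homotopic_refl_of_alpha_eq_zero (hd : 2 ≤ d) (ha : a 0 ≠ 0)
    (hR : 2 * coeffBound a + 3 ≤ R) {x : Uplus d a} {C : Path x x} (h : alpha R C = 0) :
    Path.Homotopic C (Path.refl x) := by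
  have hR0 : 0 < R := by linarith [coeffBound_nonneg a]
  obtain ⟨n, hn⟩ := exists_isLogAlong hd hR C
  obtain ⟨L, hL⟩ := hn n le_rfl
  have hL1 : L 1 = L 0 := by
    have hd0 : (d : ℂ) ≠ 0 := by exact_mod_cast (by omega : d ≠ 0)
    rw [hL.alpha_eq hd hR, div_eq_zero_iff, div_eq_zero_iff] at h
    simpa [sub_eq_zero, hd0, Complex.two_pi_I_ne_zero] using h
  let z : unitInterval → Fin (m + 2) → ℂ := fun t => (H d a)^[n] (C t)
  have hz : Continuous z :=
    (continuous_iterate_H d a n).comp (continuous_subtype_val.comp C.continuous)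
  have hz0 : ∀ t, z t 0 ≠ 0 := fun t => apply_zero_ne_zero hR (hL.mem t)
  let q : unitInterval → polarDomain m R := fun t =>
    ⟨(L t, fun j => z t j.succ / z t 0), mem_polarDomain hR0 (hL.mem t) (hL.exp_eq t)⟩
  have hq : Continuous q := by
    refine Continuous.subtype_mk (L.continuous.prodMk (continuous_pi fun j => ?_)) _
    exact ((continuous_apply _).comp hz).div ((continuous_apply _).comp hz) hz0
  have hqC : ∀ t, basinPolar hd ha hR n (q t) = C t := fun t =>
    eq_basinPolar hd ha hR (polar_eq (hL.exp_eq t))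
  have hq1 : q 1 = q 0 := Subtype.ext (by simp only [q, z, hL1, C.source, C.target])
  let c : unitInterval × unitInterval → polarDomain m R := fun p =>
    ⟨AffineMap.lineMap (q p.2).1 (q 0).1 (p.1 : ℝ),
      (convex_polarDomain m R).lineMap_mem (q p.2).2 (q 0).2 p.1.2⟩
  have hc : Continuous c := by
    refine Continuous.subtype_mk ?_ _
    simp only [AffineMap.lineMap_apply_module]
    fun_prop
  have hc0 : ∀ t, c (0, t) = q t := fun t => Subtype.ext (by simp [c])
  have hc1 : ∀ t, c (1, t) = q 0 := fun t => Subtype.ext (by simp [c])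
  -- Where the lift is at `q 0` the segment is constant, so the homotopy fixes the base point.
  have hcs : ∀ s t, q t = q 0 → c (s, t) = q 0 := fun s t ht => Subtype.ext (by simp [c, ht])
  have hx : basinPolar hd ha hR n (q 0) = x := by rw [hqC, C.source]
  refine ⟨{ toFun := fun p => basinPolar hd ha hR n (c p)
            continuous_toFun := (continuous_basinPolar hd ha hR n).comp hc
            map_zero_left := fun t => ?_
            map_one_left := fun t => ?_
            prop' := fun s t ht => ?_ }⟩
  · rw [hc0]
    exact hqC t
  · rw [hc1]
    exact hx
  · have hqt : q t = q 0 := by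
      rcases ht with rfl | rfl
      exacts [rfl, hq1]
    change basinPolar hd ha hR n (c (s, t)) = C t
    rw [hcs s t hqt, ← hqC t, hqt]

theorem exists_alpha_eq (hd : 2 ≤ d) (ha : a 0 ≠ 0) (hR : 2 * coeffBound a + 3 ≤ R)
    (x : Uplus d a) {r : ℂ} (hr : r ∈ ZInv d) : ∃ C : Path x x, alpha R C = r := by
  have hR0 : 0 < R := by linarith [coeffBound_nonneg a]
  obtain ⟨N, hN⟩ := exists_eq_div_pow_of_mem_ZInv hd hr
  obtain ⟨M, hM⟩ := exists_iterate_mem_Vplus x.2 R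
  obtain ⟨j, rfl⟩ := hN (max N M) (le_max_left _ _)
  have hn := iterate_mem_Vplus_of_le hd hR (le_max_right N M) hM
  generalize max N M = n at hn
  -- The first coordinate of `Hⁿ(x)` is turned `j` times around `0` with the ratios `z_i/z₁` fixed.
  -- The real part of `L` is constant, so the path stays in `polarDomain`.
  let L : C(unitInterval, ℂ) := ⟨fun t => Complex.log ((H d a)^[n] (x : Fin (m + 2) → ℂ) 0) +
    ((t : ℝ) * j : ℝ) * (2 * Real.pi * Complex.I), by fun_prop⟩
  have hlog := Complex.exp_log (apply_zero_ne_zero hR hn)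
  have hmem := mem_polarDomain hR0 hn hlog
  let q : unitInterval → polarDomain m R := fun t => ⟨(L t, fun i =>
    (H d a)^[n] (x : Fin (m + 2) → ℂ) i.succ / (H d a)^[n] (x : Fin (m + 2) → ℂ) 0), by
      refine ⟨?_, hmem.2⟩
      have him : (L t).re = (Complex.log ((H d a)^[n] (x : Fin (m + 2) → ℂ) 0)).re := by
        simp [L]
      rw [him]
      exact hmem.1⟩
  have hq : Continuous q :=
    Continuous.subtype_mk (L.continuous.prodMk continuous_const) _
  have hend : ∀ t, Complex.exp (L t) = (H d a)^[n] (x : Fin (m + 2) → ℂ) 0 →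
      basinPolar hd ha hR n (q t) = x := fun t ht =>
    eq_basinPolar hd ha hR (polar_eq ht)
  have h0 : L 0 = Complex.log ((H d a)^[n] (x : Fin (m + 2) → ℂ) 0) := by simp [L]
  have h1 : L 1 = Complex.log ((H d a)^[n] (x : Fin (m + 2) → ℂ) 0) +
      j * (2 * Real.pi * Complex.I) := by simp [L]
  let C : Path x x :=
    { toFun := fun t => basinPolar hd ha hR n (q t)
      continuous_toFun := (continuous_basinPolar hd ha hR n).comp hq
      source' := hend 0 (by rw [h0, hlog])
      target' := hend 1 (by
        rw [h1, Complex.exp_add, Complex.exp_int_mul_two_pi_mul_I, mul_one, hlog]) }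
  have hC : ∀ t, (H d a)^[n] (C t) = polar (q t).1 := fun t => iterate_basinPolar hd ha hR n (q t)
  have h : IsLogAlong R C n L :=
    ⟨fun t => hC t ▸ polar_mem_Vplus hR0 (q t).2, fun t => by rw [hC]; rfl⟩
  refine ⟨C, ?_⟩
  rw [h.alpha_eq hd hR, h0, h1, add_sub_cancel_left,
    mul_div_cancel_right₀ _ Complex.two_pi_I_ne_zero]

/-! ### The isomorphism with `ℤ[1/d]` -/

theorem homotopic_refl_iff (hd : 2 ≤ d) (ha : a 0 ≠ 0) (hR : 2 * coeffBound a + 3 ≤ R)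
    {x : Uplus d a} (C : Path x x) : Path.Homotopic C (Path.refl x) ↔ alpha R C = 0 :=
  ⟨fun h => (alpha_eq_of_homotopic hd hR h).trans (alpha_refl hd hR x),
    homotopic_refl_of_alpha_eq_zero hd ha hR⟩

/-- The homomorphism from the fundamental group to `ℤ[1/d]` induced by `α`. -/
def alphaHom (hd : 2 ≤ d) (hR : 2 * coeffBound a + 3 ≤ R) (x : Uplus d a) :
    FundamentalGroup (Uplus d a) x →* Multiplicative (ZInv d) :=
  MonoidHom.mk' (fun p => Multiplicative.ofAdd (Quotient.lift
    (s := Path.Homotopic.setoid x x)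
    (fun C : Path x x => (⟨alpha R C, alpha_mem_ZInv hd hR C⟩ : ZInv d))
    (fun _ _ h => Subtype.ext (alpha_eq_of_homotopic hd hR h)) p)) (by
      intro p q
      induction p using Quotient.inductionOn with | _ C
      induction q using Quotient.inductionOn with | _ C'
      -- The product in `FundamentalGroup` is composition of morphisms, so the class of `C` times
      -- that of `C'` is represented by `C'.trans C`.
      exact congrArg Multiplicative.ofAdd
        (Subtype.ext ((alpha_trans hd hR C' C).trans (add_comm _ _))))

theorem alphaHom_mk (hd : 2 ≤ d) (hR : 2 * coeffBound a + 3 ≤ R) {x : Uplus d a}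
    (C : Path x x) :
    ((Multiplicative.toAdd (alphaHom hd hR x
      (FundamentalGroup.fromPath (Path.Homotopic.Quotient.mk C))) : ZInv d) : ℂ) = alpha R C :=
  rfl

theorem alphaHom_bijective (hd : 2 ≤ d) (ha : a 0 ≠ 0) (hR : 2 * coeffBound a + 3 ≤ R)
    (x : Uplus d a) : Function.Bijective (alphaHom hd hR x) := by
  constructor
  · rw [injective_iff_map_eq_one]
    intro p hp
    induction p using Quotient.inductionOn with | _ C
    refine Path.Homotopic.Quotient.eq.2 ((homotopic_refl_iff hd ha hR C).2 ?_)
    exact congrArg (fun r => ((Multiplicative.toAdd r : ZInv d) : ℂ)) hp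
  · intro r
    obtain ⟨C, hC⟩ := exists_alpha_eq hd ha hR x (Multiplicative.toAdd r).2
    exact ⟨FundamentalGroup.fromPath (Path.Homotopic.Quotient.mk C), Subtype.ext hC⟩

end Covering

end AttractingBasin

end

theorem mainTheorem2 (m d : ℕ) (hd : 2 ≤ d) (a : Fin (m + 1) → ℂ)
    (ha : a 0 ≠ 0) (had : ‖a 0‖ < d) :
    PathConnectedSpace (AttractingBasin.Uplus d a) ∧
    ∃ R₀ : ℝ, ∀ R : ℝ, R₀ ≤ R →
      -- the integral of `ω` along every closed curve exists
      (∀ (x : AttractingBasin.Uplus d a) (C : Path x x),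
        AttractingBasin.FormIntegrable (AttractingBasin.omega d a R)
          (AttractingBasin.ambient C)) ∧
      -- (1)
      (∀ (x : AttractingBasin.Uplus d a) (C : Path x x),
        AttractingBasin.alpha R (C.map (AttractingBasin.continuous_HU d a)) =
          d * AttractingBasin.alpha R C) ∧
      -- (2)
      (∀ (x : AttractingBasin.Uplus d a) (C : Path x x),
        AttractingBasin.alpha R C ∈ AttractingBasin.ZInv d) ∧
      -- (3)
      (∀ (x : AttractingBasin.Uplus d a) (C : Path x x),
        Path.Homotopic C (Path.refl x) ↔ AttractingBasin.alpha R C = 0) ∧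
      -- (4)
      (∀ r ∈ AttractingBasin.ZInv d, ∃ (x : AttractingBasin.Uplus d a) (C : Path x x),
        AttractingBasin.alpha R C = r) ∧
      -- `α` induces an isomorphism of the fundamental group onto the additive group `ℤ[1/d]`
      (∀ x : AttractingBasin.Uplus d a,
        ∃ Φ : FundamentalGroup (AttractingBasin.Uplus d a) x ≃*
            Multiplicative (AttractingBasin.ZInv d),
          ∀ C : Path x x,
            ((Multiplicative.toAdd (Φ (FundamentalGroup.fromPath (Path.Homotopic.Quotient.mk C))) :
              AttractingBasin.ZInv d) : ℂ) = AttractingBasin.alpha R C) := by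
  refine ⟨AttractingBasin.pathConnectedSpace_Uplus hd ha,
    2 * AttractingBasin.coeffBound a + 3, fun R hR => ⟨?_, ?_, ?_, ?_, ?_, ?_⟩⟩
  · exact fun x C => AttractingBasin.formIntegrable_omega hd hR C
  · exact fun x C => AttractingBasin.alpha_map_HU hd hR C
  · exact fun x C => AttractingBasin.alpha_mem_ZInv hd hR C
  · exact fun x C => AttractingBasin.homotopic_refl_iff hd ha hR C
  · intro r hr
    have := AttractingBasin.pathConnectedSpace_Uplus (m := m) hd ha
    exact ⟨Classical.arbitrary _, AttractingBasin.exists_alpha_eq hd ha hR _ hr⟩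
  · exact fun x => ⟨MulEquiv.ofBijective _ (AttractingBasin.alphaHom_bijective hd ha hR x),
      fun C => AttractingBasin.alphaHom_mk hd hR C⟩
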